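/- Let $(E,d)$ be a complete separable metric space with its Borel $\sigma$-algebra, and let $\mathbb{R}^+=[0,\infty)$. For a metric space $S$ let $D_S(\mathbb{R}^+)$ be the space of c\`adl\`ag paths $x:\mathbb{R}^+\to S$ (right-continuous with left limits) with the Skorokhod ($J_1$) topology, in which $x_n\to x$ if and only if for every $T\ge 0$ there are increasing bijections $\tau_n$ of $\mathbb{R}^+$ with $\sup_{t\le T}|\tau_n(t)-t|\to 0$ and $\sup_{t\le T} d_S\big(x(t),x_n(\tau_n(t))\big)\to 0$. Let $\mathcal{P}(E)$ and $\mathcal{P}(D_E(\mathbb{R}^+))$ be the spaces of Borel probability measures on $E$ and on $D_E(\mathbb{R}^+)$, with the topology of weak convergence; the one on $\mathcal{P}(E)$ is metrized by the Prokhorov metric. For $\mathbb{P}\in\mathcal{P}(D_E(\mathbb{R}^+))$ let $X(t)$ be the coordinate process $X(t)(x)=x(t)$, let $X(t-)(x)=\lim_{s\uparrow t}x(s)$ for $t>0$, and let $$\phi:\mathcal{P}(D_E(\mathbb{R}^+))\to D_{\mathcal{P}(E)}(\mathbb{R}^+),\qquad \phi(\mathbb{P})=\big(\mathbb{P}\circ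 X(t)^{-1}\big)_{t\ge 0},$$ be the map that sends a law on path space to the trajectory of its time marginals (this trajectory is c\`adl\`ag for weak convergence). Then $\phi$ is continuous at every $\mathbb{P}\in\mathcal{P}(D_E(\mathbb{R}^+))$ such that $\mathbb{P}[X(t)=X(t-)]=1$ for every $t>0$. -/

import Mathlib

open MeasureTheory Filter Topology Set
open scoped NNReal

/-- A càdlàg path `[0, ∞) → S`: right-continuous at every time, with left limits. (At `t = 0` the
filter `𝓝[<] t` is trivial, so the second condition says nothing there.) -/
structure CadlagPath (S : Type*) [TopologicalSpace S] where
  toFun : ℝ≥0 → S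
  right_continuous : ∀ t, ContinuousWithinAt toFun (Ici t) t
  left_limit : ∀ t, ∃ l, Tendsto toFun (𝓝[<] t) (𝓝 l)

namespace CadlagPath

instance {S : Type*} [TopologicalSpace S] : CoeFun (CadlagPath S) (fun _ => ℝ≥0 → S) := ⟨toFun⟩

/-- The left limit `x(t-) = lim_{s ↑ t} x(s)` (with `x(0-) = x(0)`). -/
noncomputable def leftLim {S : Type*} [TopologicalSpace S] (x : CadlagPath S) (t : ℝ≥0) : S :=
  Function.leftLim x.toFun t

/-- The pairs of paths `(x, y)` for which there is a time change `τ`, that is, an increasing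
bijection of `[0, ∞)`, such that on the time interval `[0, T]` the time change is `ε`-close to the
identity and `x` is `ε`-close to `y ∘ τ`. -/
def skorokhodEntourage (S : Type*) [PseudoMetricSpace S] (T : ℝ≥0) (ε : ℝ) :
    Set (CadlagPath S × CadlagPath S) :=
  {p | ∃ τ : ℝ≥0 ≃o ℝ≥0, ∀ t ≤ T, dist (τ t) t < ε ∧ dist (p.1 t) (p.2 (τ t)) < ε}

lemma skorokhodEntourage_mono {S : Type*} [PseudoMetricSpace S] {T T' : ℝ≥0} {ε ε' : ℝ}
    (hT : T ≤ T') (hε : ε' ≤ ε) : skorokhodEntourage S T' ε' ⊆ skorokhodEntourage S T ε := by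
  rintro p ⟨τ, h⟩
  exact ⟨τ, fun t ht => ⟨(h t (ht.trans hT)).1.trans_le hε, (h t (ht.trans hT)).2.trans_le hε⟩⟩

/-- The sets `skorokhodEntourage S T ε`, for `T ≥ 0` and `ε > 0`, form a filter basis. -/
def skorokhodBasis (S : Type*) [PseudoMetricSpace S] :
    FilterBasis (CadlagPath S × CadlagPath S) where
  sets := {U | ∃ (T : ℝ≥0) (ε : ℝ), 0 < ε ∧ U = skorokhodEntourage S T ε}
  nonempty := ⟨_, 0, 1, one_pos, rfl⟩
  inter_sets := by
    rintro _ _ ⟨T, ε, hε, rfl⟩ ⟨T', ε', hε', rfl⟩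
    exact ⟨_, ⟨max T T', min ε ε', lt_min hε hε', rfl⟩,
      subset_inter (skorokhodEntourage_mono (le_max_left _ _) (min_le_left _ _))
        (skorokhodEntourage_mono (le_max_right _ _) (min_le_right _ _))⟩

/-- The Skorokhod (`J₁`) topology on the space `D_S([0, ∞))` of càdlàg paths in a metric space `S`,
presented through a uniform structure with basis `skorokhodEntourage S T ε`, `T ≥ 0`, `ε > 0`.
Thus `xₙ → x` if and only if for every `T` there are time changes `τₙ` such that
`sup_{t ≤ T} |τₙ(t) - t| → 0` and `sup_{t ≤ T} d(x(t), xₙ(τₙ(t))) → 0`. -/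
instance skorokhodUniformSpace (S : Type*) [PseudoMetricSpace S] : UniformSpace (CadlagPath S) :=
  UniformSpace.ofCore <| UniformSpace.Core.mkOfBasis (skorokhodBasis S)
    (by
      rintro _ ⟨T, ε, hε, rfl⟩ x
      exact ⟨OrderIso.refl _, fun t _ => by simpa using hε⟩)
    (by
      rintro _ ⟨T, ε, hε, rfl⟩
      refine ⟨_, ⟨T + ⟨ε, hε.le⟩, ε, hε, rfl⟩, ?_⟩
      rintro ⟨x, y⟩ ⟨τ, h⟩
      refine ⟨τ.symm, fun t ht => ?_⟩
      have h1 : τ.symm t ≤ T + ⟨ε, hε.le⟩ := by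
        rw [OrderIso.symm_apply_le]
        have h2 := (h (T + ⟨ε, hε.le⟩) le_rfl).1
        rw [NNReal.dist_eq, abs_lt] at h2
        have h3 : ((T + ⟨ε, hε.le⟩ : ℝ≥0) : ℝ) = T + ε := rfl
        rw [h3] at h2
        refine ht.trans ?_
        rw [← NNReal.coe_le_coe]
        linarith [h2.1]
      have h2 := h _ h1
      simp only [OrderIso.apply_symm_apply] at h2
      exact ⟨by rw [dist_comm]; exact h2.1, by rw [dist_comm]; exact h2.2⟩)
    (by
      rintro _ ⟨T, ε, hε, rfl⟩
      refine ⟨_, ⟨T + ⟨ε, hε.le⟩, ε / 2, half_pos hε, rfl⟩, ?_⟩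
      rintro ⟨x, z⟩ ⟨y, ⟨τ, h⟩, ⟨σ, h'⟩⟩
      refine ⟨τ.trans σ, fun t ht => ?_⟩
      obtain ⟨h1, h2⟩ := h t (ht.trans le_self_add)
      have h3 : τ t ≤ T + ⟨ε, hε.le⟩ := by
        rw [NNReal.dist_eq, abs_lt] at h1
        have h3 : ((T + ⟨ε, hε.le⟩ : ℝ≥0) : ℝ) = T + ε := rfl
        rw [← NNReal.coe_le_coe] at ht ⊢
        rw [h3]
        linarith [h1.2]
      obtain ⟨h4, h5⟩ := h' _ h3
      constructor
      · calc dist (σ (τ t)) t ≤ dist (σ (τ t)) (τ t) + dist (τ t) t := dist_triangle _ _ _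
          _ < ε := by linarith
      · calc dist (x t) (z (σ (τ t))) ≤ dist (x t) (y (τ t)) + dist (y (τ t)) (z (σ (τ t))) :=
              dist_triangle _ _ _
          _ < ε := by linarith)

lemma hasBasis_uniformity (S : Type*) [PseudoMetricSpace S] :
    (uniformity (CadlagPath S)).HasBasis (fun p : ℝ≥0 × ℝ => 0 < p.2)
      (fun p => skorokhodEntourage S p.1 p.2) := by
  refine ⟨fun U => (skorokhodBasis S).mem_filter_iff.trans ⟨?_, ?_⟩⟩
  · rintro ⟨_, ⟨T, ε, hε, rfl⟩, h⟩
    exact ⟨(T, ε), hε, h⟩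
  · rintro ⟨⟨T, ε⟩, hε, h⟩
    exact ⟨_, ⟨T, ε, hε, rfl⟩, h⟩

/-- The Borel σ-algebra of the Skorokhod topology. -/
instance (S : Type*) [PseudoMetricSpace S] : MeasurableSpace (CadlagPath S) := borel _

instance (S : Type*) [PseudoMetricSpace S] : BorelSpace (CadlagPath S) := ⟨rfl⟩

/-- Paths staying in a closed set during an open time interval form a closed set. -/
lemma isClosed_forall_mem {S : Type*} [PseudoMetricSpace S] {C : Set S} (hC : IsClosed C)
    (a b : ℝ≥0) : IsClosed {x : CadlagPath S | ∀ s ∈ Ioo a b, x s ∈ C} := by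
  rw [← isOpen_compl_iff, isOpen_iff_mem_nhds]
  intro x hx
  simp only [mem_compl_iff, mem_ofPred_eq, not_forall] at hx
  obtain ⟨s, hs, hxs⟩ := hx
  obtain ⟨δ, hδ, hball⟩ := Metric.isOpen_iff.1 hC.isOpen_compl _ hxs
  obtain ⟨η, hη, hη'⟩ := Metric.isOpen_iff.1 isOpen_Ioo s hs
  rw [(nhds_basis_uniformity' (hasBasis_uniformity S)).mem_iff]
  refine ⟨(s, min δ η), lt_min hδ hη, ?_⟩
  rintro y ⟨τ, hτ⟩ hy
  obtain ⟨h1, h2⟩ := hτ s le_rfl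
  have h3 : τ s ∈ Ioo a b := hη' (h1.trans_le (min_le_right _ _))
  refine hball ?_ (hy _ h3)
  rw [Metric.mem_ball, dist_comm]
  exact h2.trans_le (min_le_left _ _)

/-- The evaluation `π_t : x ↦ x(t)` is Borel measurable on the Skorokhod space. -/
lemma measurable_eval {S : Type*} [PseudoMetricSpace S] [MeasurableSpace S] [BorelSpace S]
    (t : ℝ≥0) : Measurable (fun x : CadlagPath S => x t) := by
  refine measurable_of_isClosed fun F hF => ?_
  have key : (fun x : CadlagPath S => x t) ⁻¹' F = ⋂ k : ℕ, ⋃ m : ℕ,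
      {x : CadlagPath S | ∀ s ∈ Ioo t (t + 1 / ((m : ℝ≥0) + 1)),
        x s ∈ Metric.cthickening (1 / ((k : ℝ) + 1)) F} := by
    ext x
    simp only [mem_preimage, mem_iInter, mem_iUnion, mem_ofPred_eq]
    constructor
    · intro hx k
      have hk : (0 : ℝ) < 1 / ((k : ℝ) + 1) := by positivity
      have h1 : ∀ᶠ s in 𝓝[≥] t, x s ∈ Metric.cthickening (1 / ((k : ℝ) + 1)) F :=
        (x.right_continuous t).eventually
          (mem_of_superset (Metric.isOpen_thickening.mem_nhds
            (Metric.self_subset_thickening hk F hx)) (Metric.thickening_subset_cthickening _ _))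
      rw [eventually_nhdsWithin_iff, Metric.eventually_nhds_iff] at h1
      obtain ⟨ε, hε, h1⟩ := h1
      obtain ⟨m, hm⟩ := exists_nat_one_div_lt hε
      refine ⟨m, fun s hs => h1 ?_ hs.1.le⟩
      obtain ⟨hs1, hs2⟩ := hs
      rw [← NNReal.coe_lt_coe] at hs1 hs2
      push_cast at hs2
      rw [NNReal.dist_eq, abs_lt]
      constructor <;> linarith
    · intro h
      have hF' := hF.closure_eq
      rw [← hF', Metric.closure_eq_iInter_cthickening' F (range fun k : ℕ => 1 / ((k : ℝ) + 1))]
      · simp only [mem_iInter]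
        rintro _ ⟨k, rfl⟩
        obtain ⟨m, hm⟩ := h k
        have hlt : t < t + 1 / ((m : ℝ≥0) + 1) := lt_add_of_pos_right t (by positivity)
        have hev : ∀ᶠ s in 𝓝[>] t, x s ∈ Metric.cthickening (1 / ((k : ℝ) + 1)) F := by
          filter_upwards [Ioo_mem_nhdsGT hlt] with s hs using hm s hs
        exact Metric.isClosed_cthickening.mem_of_tendsto
          ((x.right_continuous t).mono_left (nhdsWithin_mono t Ioi_subset_Ici_self)) hev
      · intro ε hε
        obtain ⟨k, hk⟩ := exists_nat_one_div_lt hε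
        exact ⟨_, ⟨k, rfl⟩, Nat.one_div_pos_of_nat, hk.le⟩
  rw [key]
  exact MeasurableSet.iInter fun k => MeasurableSet.iUnion fun m =>
    (isClosed_forall_mem Metric.isClosed_cthickening _ _).measurableSet

end CadlagPath

/-- The Prokhorov metric on the space `𝒫(E)` of Borel probability measures on a separable metric
space. Its topology is, definitionally, the topology of weak convergence. -/
noncomputable instance prokhorovMetricSpace (E : Type*) [MetricSpace E]
    [TopologicalSpace.SeparableSpace E] [MeasurableSpace E] [BorelSpace E] :
    MetricSpace (ProbabilityMeasure E) :=
  (MetricSpace.induced (LevyProkhorov.ofMeasure (α := ProbabilityMeasure E))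
    LevyProkhorov.toMeasureEquiv.symm.injective inferInstance).replaceTopology
    LevyProkhorov.probabilityMeasureHomeomorph.isInducing.eq_induced

namespace CadlagPath

variable {E : Type*} [MetricSpace E] [MeasurableSpace E] [BorelSpace E]

/-- The law `φ_t(P) = P ∘ π_t⁻¹` of the time-`t` marginal of a law `P` on path space. -/
noncomputable def marginal (P : ProbabilityMeasure (CadlagPath E)) (t : ℝ≥0) :
    ProbabilityMeasure E :=
  P.map (f := fun x : CadlagPath E => x t) (measurable_eval t).aemeasurable

lemma tendsto_marginal (P : ProbabilityMeasure (CadlagPath E)) {l : Filter ℝ≥0}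
    [l.IsCountablyGenerated] {g : CadlagPath E → E} (hg : Measurable g)
    (h : ∀ x : CadlagPath E, Tendsto x.toFun l (𝓝 (g x))) :
    Tendsto (marginal P) l (𝓝 (P.map hg.aemeasurable)) := by
  rw [ProbabilityMeasure.tendsto_iff_forall_integral_tendsto]
  intro f
  have h1 : ∀ t, ∫ ω, f ω ∂(marginal P t : Measure E) =
      ∫ x : CadlagPath E, f (x t) ∂(P : Measure (CadlagPath E)) := fun t =>
    integral_map (measurable_eval t).aemeasurable
      f.continuous.measurable.stronglyMeasurable.aestronglyMeasurable
  have h2 : ∫ ω, f ω ∂(P.map hg.aemeasurable : Measure E) =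
      ∫ x, f (g x) ∂(P : Measure (CadlagPath E)) :=
    integral_map hg.aemeasurable
      f.continuous.measurable.stronglyMeasurable.aestronglyMeasurable
  simp only [h1, h2]
  refine tendsto_integral_filter_of_dominated_convergence (fun _ => ‖f‖) ?_ ?_
    (integrable_const _) ?_
  · exact Eventually.of_forall fun t =>
      (f.continuous.measurable.comp (measurable_eval t)).stronglyMeasurable.aestronglyMeasurable
  · exact Eventually.of_forall fun t => Eventually.of_forall fun x => f.norm_coe_le_norm _
  · exact Eventually.of_forall fun x => (f.continuous.tendsto _).comp (h x)

/-- The map `φ : 𝒫(D_E([0, ∞))) → D_{𝒫(E)}([0, ∞))` sending a law on path space to the trajectory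
`t ↦ P ∘ π_t⁻¹` of its time marginals. -/
noncomputable def marginalTrajectory [TopologicalSpace.SeparableSpace E]
    (P : ProbabilityMeasure (CadlagPath E)) : CadlagPath (ProbabilityMeasure E) where
  toFun := marginal P
  right_continuous t := tendsto_marginal P (measurable_eval t) fun x => x.right_continuous t
  left_limit t := by
    rcases eq_or_ne t 0 with rfl | ht
    · exact ⟨marginal P 0, by
        have h0 : Iio (0 : ℝ≥0) = ∅ := by ext; simp
        rw [h0, nhdsWithin_empty]; exact tendsto_bot⟩
    · have hne : (𝓝[<] t).NeBot := nhdsLT_neBot_of_exists_lt ⟨0, pos_iff_ne_zero.2 ht⟩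
      have hl : ∀ x : CadlagPath E, Tendsto x.toFun (𝓝[<] t) (𝓝 (x.leftLim t)) :=
        fun x => tendsto_leftLim_of_tendsto (x.left_limit t)
      have hm : Measurable fun x : CadlagPath E => x.leftLim t := by
        refine measurable_of_tendsto_metrizable' (𝓝[<] t) (fun s => measurable_eval s) ?_
        exact tendsto_pi_nhds.2 hl
      exact ⟨_, tendsto_marginal P hm hl⟩

end CadlagPath

open CadlagPath TopologicalSpace
open scoped ENNReal

/-! Without fixed jumps, for each `t`, `P`-almost every path is continuous at `t`. At such a path
`x` the evaluation `(y, s) ↦ y s` is jointly continuous at `(x, t)`: Skorokhod-close paths have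
nearby values at all times near `t`. Passing to laws by portmanteau, `(Q, s) ↦ marginal Q s` is
continuous at `(P, t)` (`tendsto_marginal_nhds`). Compactness of `[0, T]` makes this uniform in
time, so the marginals of `Q` are Prokhorov-close to those of `P` on all of `[0, T]`, and no time
change is needed. The argument uses neighbourhood filters of laws rather than sequences, hence a
portmanteau criterion valid along any filter. -/

/-- For a general filter, weak convergence of probability measures on a second countable metrizable
space follows from lower semicontinuity on open sets. -/
theorem MeasureTheory.ProbabilityMeasure.tendsto_of_forall_isOpen_eventually_lt
    {Ω ι : Type*} [TopologicalSpace Ω] [SecondCountableTopology Ω] [PseudoMetrizableSpace Ω]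
    [MeasurableSpace Ω] [OpensMeasurableSpace Ω] {μ : ProbabilityMeasure Ω}
    {μs : ι → ProbabilityMeasure Ω} {l : Filter ι}
    (h : ∀ G, IsOpen G → ∀ c : ℝ≥0, c < μ G → ∀ᶠ i in l, c < μs i G) :
    Tendsto μs l (𝓝 μ) := by
  classical
  -- Finitely many members of a countable basis and rational levels suffice; the corresponding
  -- filter is countably generated.
  let U (T : Finset (countableBasis Ω)) : Set Ω := ⋃ s ∈ T, (s : Set Ω)
  have hU (T) : IsOpen (U T) := isOpen_biUnion fun s _ => isOpen_of_mem_countableBasis s.2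
  have : Countable (countableBasis Ω) := (countable_countableBasis Ω).to_subtype
  let L : Filter (ProbabilityMeasure Ω) :=
    ⨅ p : {p : Finset (countableBasis Ω) × ℚ≥0 // (p.2 : ℝ≥0) < μ (U p.1)},
      𝓟 {Q | (p.1.2 : ℝ≥0) < Q (U p.1.1)}
  have hL : Tendsto (fun Q : ProbabilityMeasure Ω => Q) L (𝓝 μ) := by
    refine tendsto_of_forall_isOpen_le_liminf' fun G hG => le_of_forall_lt fun c hc => ?_
    obtain ⟨d, hcd, hd⟩ := ENNReal.lt_iff_exists_nnreal_btwn.1 hc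
    rw [← ProbabilityMeasure.ennreal_coeFn_eq_coeFn_toMeasure, ENNReal.coe_lt_coe] at hd
    obtain ⟨T, hTS, hT, hTG⟩ := μ.exists_lt_measure_biUnion_of_isOpen (S := countableBasis Ω)
      (fun u hu x hx => by
        obtain ⟨s, hs, hxs, hsu⟩ := (isBasis_countableBasis Ω).exists_subset_of_mem_open hx hu
        exact ⟨s, hs, (isOpen_of_mem_countableBasis hs).mem_nhds hxs, hsu⟩) hG hd
    have hUT : U (T.subtype (· ∈ countableBasis Ω)) = ⋃ t ∈ T, t := by
      ext x
      simp only [U, mem_iUnion, Finset.mem_subtype, exists_prop, Subtype.exists]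
      exact ⟨fun ⟨s, _, h1, h2⟩ => ⟨s, h1, h2⟩, fun ⟨s, h1, h2⟩ => ⟨s, hTS s h1, h1, h2⟩⟩
    -- Only rational levels index `L`; this keeps `L` countably generated.
    obtain ⟨q, hdq, hq⟩ : ∃ q : ℚ≥0, d < (q : ℝ≥0) ∧ (q : ℝ≥0) < μ (⋃ t ∈ T, t) := by
      obtain ⟨q, h1, h2⟩ := exists_rat_btwn (NNReal.coe_lt_coe.2 hT)
      have hq0 : 0 ≤ q := by exact_mod_cast (d.coe_nonneg.trans h1.le)
      lift q to ℚ≥0 using hq0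
      exact ⟨q, by exact_mod_cast h1, by exact_mod_cast h2⟩
    refine hcd.trans_le (le_liminf_of_le (by isBoundedDefault) ?_)
    have hmem : {Q : ProbabilityMeasure Ω | (q : ℝ≥0) < Q (⋃ t ∈ T, t)} ∈ L := by
      rw [← hUT] at hq ⊢
      exact mem_iInf_of_mem ⟨(_, q), hq⟩ (mem_principal_self _)
    filter_upwards [hmem] with Q hQ
    rw [← ProbabilityMeasure.ennreal_coeFn_eq_coeFn_toMeasure, ENNReal.coe_le_coe]
    exact (hdq.trans hQ).le.trans (ProbabilityMeasure.apply_mono Q hTG)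
  refine Tendsto.mono_right ?_ hL
  exact tendsto_iInf.2 fun p => tendsto_principal.2 (h _ (hU _) _ p.2)

namespace CadlagPath

/-- Integer horizons `n` with tolerances `1 / (n + 1)` already generate the uniformity.
Pseudometrizability lets the open-set portmanteau inequality apply to laws on path space. -/
instance pseudoMetrizableSpace (S : Type*) [PseudoMetricSpace S] :
    PseudoMetrizableSpace (CadlagPath S) := by
  have : (uniformity (CadlagPath S)).IsCountablyGenerated := by
    refine HasBasis.isCountablyGenerated (ι := ℕ)
      (p := fun _ => True) (s := fun n => skorokhodEntourage S n (1 / ((n : ℝ) + 1))) ?_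
    refine (hasBasis_uniformity S).to_hasBasis ?_ fun n _ => ⟨(n, _), by positivity, subset_rfl⟩
    rintro ⟨T, ε⟩ hε
    obtain ⟨n, hn⟩ := exists_nat_ge T
    obtain ⟨m, hm⟩ := exists_nat_one_div_lt hε
    refine ⟨max n m, trivial, skorokhodEntourage_mono (hn.trans ?_) (le_trans ?_ hm.le)⟩
    · exact_mod_cast le_max_left n m
    · exact one_div_le_one_div_of_le (by positivity)
        (by gcongr; exact le_max_right n m)
  exact UniformSpace.pseudoMetrizableSpace

/-- A path without a jump at `t` is continuous at `t`. -/
lemma continuousAt_of_eq_leftLim {S : Type*} [TopologicalSpace S] {x : CadlagPath S} {t : ℝ≥0}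
    (h : 0 < t → x t = x.leftLim t) : ContinuousAt x.toFun t := by
  refine continuousAt_iff_continuous_left'_right'.2
    ⟨?_, (x.right_continuous t).mono Ioi_subset_Ici_self⟩
  rcases eq_zero_or_pos t with rfl | ht
  · have h0 : Iio (0 : ℝ≥0) = ∅ := by ext; simp
    rw [h0]
    simp [ContinuousWithinAt]
  · have h1 : Tendsto x.toFun (𝓝[<] t) (𝓝 (x.leftLim t)) :=
      tendsto_leftLim_of_tendsto (x.left_limit t)
    rwa [← h ht] at h1

/-- If a path is continuous at `t` with value in an open set `G`, then all Skorokhod-close paths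
stay in `G` on a common neighbourhood of `t`. -/
lemma exists_setOf_forall_mem_mem_nhds {S : Type*} [PseudoMetricSpace S] {x : CadlagPath S}
    {t : ℝ≥0} (hx : ContinuousAt x.toFun t) {G : Set S} (hG : IsOpen G) (hxG : x t ∈ G) :
    ∃ n : ℕ, {y : CadlagPath S | ∀ s ∈ Metric.ball t (1 / ((n : ℝ) + 1)), y s ∈ G} ∈ 𝓝 x := by
  obtain ⟨r, hr, hrG⟩ := Metric.isOpen_iff.1 hG _ hxG
  obtain ⟨η, hη, hball⟩ := Metric.continuousAt_iff.1 hx (r / 2) (half_pos hr)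
  obtain ⟨n, hn⟩ := exists_nat_one_div_lt (half_pos hη)
  refine ⟨n, ?_⟩
  -- This orientation makes the time change act on the times of `y`: `y s` is compared with `x (τ
  -- s)` for every `s` near `t`. The horizon `t + 1` covers the ball, whose radius is at most `1`.
  rw [(nhds_basis_uniformity (hasBasis_uniformity S)).mem_iff]
  refine ⟨(t + 1, min (η / 2) (r / 2)), by positivity, ?_⟩
  rintro y ⟨τ, hτ⟩ s hs
  rw [Metric.mem_ball] at hs
  have hs1 : s ≤ t + 1 := by
    have h1 : dist s t < 1 := hs.trans_le (by
      rw [div_le_one (by positivity)]; linarith [n.cast_nonneg (α := ℝ)])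
    rw [NNReal.dist_eq, abs_lt] at h1
    rw [← NNReal.coe_le_coe]
    push_cast
    linarith
  obtain ⟨h1, h2⟩ := hτ s hs1
  have h3 : dist (τ s) t < η := by
    linarith [dist_triangle (τ s) s t, h1.trans_le (min_le_left _ _)]
  refine hrG ?_
  rw [Metric.mem_ball]
  have h4 := hball h3
  have h5 := h2.trans_le (min_le_right _ _)
  have h6 := dist_triangle (y s) (x (τ s)) (x t)
  dsimp only at h5
  linarith

/-- If almost no path jumps at time `t`, then the marginal `Q ∘ π_s⁻¹` depends continuously on
`(Q, s)` at `(P, t)`. -/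
theorem tendsto_marginal_nhds {E : Type*} [MetricSpace E] [SeparableSpace E] [MeasurableSpace E]
    [BorelSpace E] {P : ProbabilityMeasure (CadlagPath E)} {t : ℝ≥0}
    (hP : ∀ᵐ x ∂(P : Measure (CadlagPath E)), ContinuousAt x.toFun t) :
    Tendsto (fun q : ProbabilityMeasure (CadlagPath E) × ℝ≥0 => marginal q.1 q.2) (𝓝 (P, t))
      (𝓝 (marginal P t)) := by
  have : SecondCountableTopology E := UniformSpace.secondCountable_of_separable E
  have apply_eq (Q : ProbabilityMeasure (CadlagPath E)) (s : ℝ≥0) {G : Set E} (hG : IsOpen G) :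
      (marginal Q s : Measure E) G = (Q : Measure (CadlagPath E)) {x | x s ∈ G} :=
    Measure.map_apply (measurable_eval s) hG.measurableSet
  refine ProbabilityMeasure.tendsto_of_forall_isOpen_eventually_lt fun G hG c hc => ?_
  simp only [← ENNReal.coe_lt_coe, ProbabilityMeasure.ennreal_coeFn_eq_coeFn_toMeasure,
    apply_eq _ _ hG] at hc ⊢
  -- Taking interiors gives open sets, to which portmanteau applies; they increase to a set
  -- containing almost every path with `x t ∈ G`. One `W n` then controls all times in a ball around
  -- `t` at once.
  let W (n : ℕ) : Set (CadlagPath E) :=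
    interior {y | ∀ s ∈ Metric.ball t (1 / ((n : ℝ) + 1)), y s ∈ G}
  have hW : Monotone W := fun m n hmn => interior_mono fun y hy s hs =>
    hy s (Metric.ball_subset_ball (Nat.one_div_le_one_div hmn) hs)
  have hle : (P : Measure (CadlagPath E)) {x | x t ∈ G} ≤
      (P : Measure (CadlagPath E)) (⋃ n, W n) := by
    refine measure_mono_ae ?_
    filter_upwards [hP] with x hx hxG
    obtain ⟨n, hn⟩ := exists_setOf_forall_mem_mem_nhds hx hG hxG
    exact mem_iUnion.2 ⟨n, mem_interior_iff_mem_nhds.2 hn⟩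
  rw [hW.measure_iUnion] at hle
  obtain ⟨n, hn⟩ := lt_iSup_iff.1 (hc.trans_le hle)
  have hev : ∀ᶠ Q : ProbabilityMeasure (CadlagPath E) in 𝓝 P, (c : ℝ≥0∞) < (Q : Measure (CadlagPath E)) (W n) :=
    eventually_lt_of_lt_liminf
      (hn.trans_le (ProbabilityMeasure.le_liminf_measure_open_of_tendsto tendsto_id isOpen_interior))
  rw [nhds_prod_eq]
  filter_upwards [hev.prod_mk (Metric.ball_mem_nhds t (Nat.one_div_pos_of_nat (n := n)))]
    with q hq
  exact hq.1.trans_le (measure_mono fun y hy => interior_subset hy _ hq.2)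

end CadlagPath

theorem mainTheorem12 {E : Type*} [MetricSpace E] [CompleteSpace E]
    [TopologicalSpace.SeparableSpace E] [MeasurableSpace E] [BorelSpace E]
    (P : ProbabilityMeasure (CadlagPath E))
    (hP : ∀ t : ℝ≥0, 0 < t → P {x : CadlagPath E | x t = x.leftLim t} = 1) :
    ContinuousAt
      (CadlagPath.marginalTrajectory :
        ProbabilityMeasure (CadlagPath E) → CadlagPath (ProbabilityMeasure E)) P := by
  have hcont (t : ℝ≥0) :
      ∀ᵐ x ∂(P : Measure (CadlagPath E)), ContinuousAt x.toFun t := by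
    rcases eq_zero_or_pos t with rfl | ht
    · exact Eventually.of_forall fun x => continuousAt_of_eq_leftLim fun h => absurd h (lt_irrefl _)
    · have hm : Measurable fun x : CadlagPath E => x.leftLim t := by
        have : (𝓝[<] t).NeBot := nhdsLT_neBot_of_exists_lt ⟨0, ht⟩
        exact measurable_of_tendsto_metrizable' (𝓝[<] t) (fun s => measurable_eval s)
          (tendsto_pi_nhds.2 fun x => tendsto_leftLim_of_tendsto (x.left_limit t))
      have : SecondCountableTopology E := UniformSpace.secondCountable_of_separable E
      have h1 : ∀ᵐ x ∂(P : Measure (CadlagPath E)), x t = x.leftLim t := by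
        -- Probability one gives an almost sure statement because the no-jump event is measurable.
        refine (mem_ae_iff_prob_eq_one (measurableSet_eq_fun (measurable_eval t) hm)).2 ?_
        rw [← ProbabilityMeasure.ennreal_coeFn_eq_coeFn_toMeasure, hP t ht, ENNReal.coe_one]
      exact h1.mono fun x hx => continuousAt_of_eq_leftLim fun _ => hx
  refine (nhds_basis_uniformity' (hasBasis_uniformity _)).tendsto_right_iff.2 ?_
  rintro ⟨T, ε⟩ hε
  have key : ∀ᶠ Q in 𝓝 P, ∀ t ∈ Icc 0 T, dist (marginal P t) (marginal Q t) < ε := by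
    -- Tube-lemma argument: it suffices to bound the distance for `(Q, s)` near each `(P, t)`, where
    -- both marginals tend to `marginal P t`.
    refine isCompact_Icc.eventually_forall_of_forall_eventually fun t _ => ?_
    have h1 := tendsto_marginal_nhds (hcont t)
    have h2 : Tendsto (fun q : ProbabilityMeasure (CadlagPath E) × ℝ≥0 => marginal P q.2)
        (𝓝 (P, t)) (𝓝 (marginal P t)) :=
      h1.comp ((continuous_const.prodMk continuous_snd).tendsto' (P, t) (P, t) rfl)
    have h3 := Tendsto.dist h2 h1
    rw [dist_self] at h3
    exact h3.eventually_lt_const hε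
  filter_upwards [key] with Q hQ
  exact ⟨OrderIso.refl _, fun t ht => ⟨by simpa using hε, hQ t ⟨zero_le, ht⟩⟩⟩
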